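/- Let $k$ be a field, let $B$ be a finite-dimensional Hopf algebra over $k$ with antipode $S$, and let ${}^B_B\mathcal{YD}$ be the braided category of left-left Yetter–Drinfeld modules over $B$: left $B$-modules and left $B$-comodules $M$, with coaction $\phi(m)=\sum m_{(-1)}\otimes m_{(0)}$, such that $\phi(b\cdot m)=\sum b_1m_{(-1)}S(b_3)\otimes b_2\cdot m_{(0)}$, with braiding $C(m\otimes n)=\sum m_{(-1)}\cdot n\otimes m_{(0)}$. Let $(H,\alpha,\phi)$ be a braided Hopf algebra in ${}^B_B\mathcal{YD}$ (possibly infinite-dimensional), where $\alpha$ is the $B$-action and $\phi$ the $B$-coaction, and suppose that $\phi$ is trivial, i.e. $\phi(h)=1_B\otimes h$ for all $h\in H$. Let $H^*=\operatorname{Hom}_k(H,k)$ with the convolution product $(g*f)(h)=\sum g(h_1)f(h_2)$, and let $$\int_{H^*}^{l}=\{f\in H^* : g*f=g(1)f\ \text{ for every } g\in H^*\}.$$ Then $\dim_k\int_{H^*}^{l}$ is $0$ or $1$. -/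

import Mathlib

open scoped TensorProduct

noncomputable section

namespace BraidedIntegral

/-- The structure maps of a Yetter–Drinfeld module: a map `B ⊗ M → M`, `b ⊗ m ↦ b · m`, and a map
`M → B ⊗ M`, `m ↦ ∑ m₍₋₁₎ ⊗ m₍₀₎`. The laws are in `YDMaps.IsYetterDrinfeld`. -/
structure YDMaps (k B M : Type*) [Field k] [Ring B] [Algebra k B] [AddCommGroup M]
    [Module k M] where
  /-- the action of `B` -/
  act : B ⊗[k] M →ₗ[k] M
  /-- the coaction of `B` -/
  coact : M →ₗ[k] B ⊗[k] M

section YetterDrinfeld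

variable {k B : Type*} [Field k] [Ring B] [HopfAlgebra k B]
variable {M N : Type*} [AddCommGroup M] [Module k M] [AddCommGroup N] [Module k N]

namespace YDMaps

/-- The map `B ⊗ M → B ⊗ M`, `b ⊗ m ↦ ∑ b₁ m₍₋₁₎ ⊗ b₂ · m₍₀₎`. -/
def actCoact (X : YDMaps k B M) : B ⊗[k] M →ₗ[k] B ⊗[k] M :=
  TensorProduct.map (LinearMap.mul' k B) X.act ∘ₗ
    (TensorProduct.tensorTensorTensorComm k B B B M).toLinearMap ∘ₗ
    TensorProduct.map Coalgebra.comul X.coact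

/-- The map `B ⊗ M → B ⊗ M`, `b ⊗ m ↦ ∑ b₁ m₍₋₁₎ S(b₃) ⊗ b₂ · m₍₀₎`: split `b ⊗ m` as
`∑ (b₁ ⊗ m) ⊗ b₂`, apply `actCoact` to `b₁ ⊗ m` and the antipode to `b₂`, and multiply the outcome
of the latter into the `B`-component from the right. -/
def adjointActCoact (X : YDMaps k B M) : B ⊗[k] M →ₗ[k] B ⊗[k] M :=
  (LinearMap.mul' k B).rTensor M ∘ₗ
    (TensorProduct.rightComm k B M B).toLinearMap ∘ₗ
    TensorProduct.map X.actCoact (HopfAlgebra.antipode k) ∘ₗ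
    (TensorProduct.rightComm k B B M).toLinearMap ∘ₗ
    (Coalgebra.comul (R := k) (A := B)).rTensor M

/-- The laws of a (left-left) Yetter–Drinfeld module over the Hopf algebra `B`. -/
structure IsYetterDrinfeld (X : YDMaps k B M) : Prop where
  one_act : ∀ m : M, X.act (1 ⊗ₜ[k] m) = m
  mul_act : ∀ (a b : B) (m : M), X.act ((a * b) ⊗ₜ[k] m) = X.act (a ⊗ₜ[k] X.act (b ⊗ₜ[k] m))
  /-- `∑ ε(m₍₋₁₎) m₍₀₎ = m` -/
  counit_coact : (TensorProduct.lid k M).toLinearMap ∘ₗ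
    (Coalgebra.counit (R := k) (A := B)).rTensor M ∘ₗ X.coact = LinearMap.id
  /-- `∑ (m₍₋₁₎)₁ ⊗ (m₍₋₁₎)₂ ⊗ m₍₀₎ = ∑ m₍₋₁₎ ⊗ (m₍₀₎)₍₋₁₎ ⊗ (m₍₀₎)₍₀₎` -/
  coassoc_coact : (TensorProduct.assoc k B B M).toLinearMap ∘ₗ
    (Coalgebra.comul (R := k) (A := B)).rTensor M ∘ₗ X.coact = X.coact.lTensor B ∘ₗ X.coact
  /-- `∑ (b · m)₍₋₁₎ ⊗ (b · m)₍₀₎ = ∑ b₁ m₍₋₁₎ S(b₃) ⊗ b₂ · m₍₀₎` -/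
  coact_act : X.coact ∘ₗ X.act = X.adjointActCoact

/-- The structure maps of the unit object `k`: `b · c = ε(b) c` and `c ↦ 1 ⊗ c`. -/
def unit (k B : Type*) [Field k] [Ring B] [HopfAlgebra k B] : YDMaps k B k where
  act := (TensorProduct.rid k k).toLinearMap ∘ₗ (Coalgebra.counit (R := k) (A := B)).rTensor k
  coact := TensorProduct.mk k B k 1

/-- The structure maps of the tensor product:
`b · (m ⊗ n) = ∑ b₁ · m ⊗ b₂ · n` and `m ⊗ n ↦ ∑ m₍₋₁₎ n₍₋₁₎ ⊗ (m₍₀₎ ⊗ n₍₀₎)`. -/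
def tensor (X : YDMaps k B M) (Y : YDMaps k B N) : YDMaps k B (M ⊗[k] N) where
  act := TensorProduct.map X.act Y.act ∘ₗ
    (TensorProduct.tensorTensorTensorComm k B B M N).toLinearMap ∘ₗ
    (Coalgebra.comul (R := k) (A := B)).rTensor (M ⊗[k] N)
  coact := (LinearMap.mul' k B).rTensor (M ⊗[k] N) ∘ₗ
    (TensorProduct.tensorTensorTensorComm k B M B N).toLinearMap ∘ₗ
    TensorProduct.map X.coact Y.coact

/-- A morphism of Yetter–Drinfeld modules: a `B`-linear and `B`-colinear map. -/
structure IsHom (X : YDMaps k B M) (Y : YDMaps k B N) (f : M →ₗ[k] N) : Prop where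
  map_act : f ∘ₗ X.act = Y.act ∘ₗ f.lTensor B
  map_coact : Y.coact ∘ₗ f = f.lTensor B ∘ₗ X.coact

/-- The braiding `C : M ⊗ N → N ⊗ M`, `m ⊗ n ↦ ∑ m₍₋₁₎ · n ⊗ m₍₀₎`. -/
def braiding (X : YDMaps k B M) (Y : YDMaps k B N) : M ⊗[k] N →ₗ[k] N ⊗[k] M :=
  Y.act.rTensor M ∘ₗ (TensorProduct.rightComm k B M N).toLinearMap ∘ₗ X.coact.rTensor N

/-- The coaction is trivial: `m ↦ 1 ⊗ m`. -/
def IsTrivialCoaction (X : YDMaps k B M) : Prop :=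
  ∀ m : M, X.coact m = (1 : B) ⊗ₜ[k] m

end YDMaps

/-- The multiplication of the braided tensor product algebra `H ⊗ H`:
`(m ⊗ m) (id ⊗ C ⊗ id) : (H ⊗ H) ⊗ (H ⊗ H) → H ⊗ H`, that is,
`(u ⊗ v) ⊗ (x ⊗ y) ↦ ∑ u (v₍₋₁₎ · x) ⊗ v₍₀₎ y`. -/
def braidedMul {H : Type*} [Ring H] [Algebra k H] (X : YDMaps k B H) :
    (H ⊗[k] H) ⊗[k] (H ⊗[k] H) →ₗ[k] H ⊗[k] H :=
  TensorProduct.map (LinearMap.mul' k H) (LinearMap.mul' k H) ∘ₗ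
    (TensorProduct.assoc k H H (H ⊗[k] H)).symm.toLinearMap ∘ₗ
    ((TensorProduct.assoc k H H H).toLinearMap ∘ₗ
      (X.braiding X).rTensor H ∘ₗ
      (TensorProduct.assoc k H H H).symm.toLinearMap).lTensor H ∘ₗ
    (TensorProduct.assoc k H H (H ⊗[k] H)).toLinearMap

/-- A braided Hopf algebra (Hopf algebra in the category of Yetter–Drinfeld modules over `B`)
structure on an associative unital `k`-algebra and coassociative counital `k`-coalgebra `H`. -/
structure BraidedHopfAlgebra (k B H : Type*) [Field k] [Ring B] [HopfAlgebra k B] [Ring H]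
    [Algebra k H] [Coalgebra k H] extends YDMaps k B H where
  isYetterDrinfeld : toYDMaps.IsYetterDrinfeld
  /-- the structure maps of the algebra and of the coalgebra are morphisms -/
  isHom_mul : (toYDMaps.tensor toYDMaps).IsHom toYDMaps (LinearMap.mul' k H)
  isHom_one : (YDMaps.unit k B).IsHom toYDMaps (Algebra.linearMap k H)
  isHom_comul : toYDMaps.IsHom (toYDMaps.tensor toYDMaps) Coalgebra.comul
  isHom_counit : toYDMaps.IsHom (YDMaps.unit k B) Coalgebra.counit
  /-- comultiplication and counit are homomorphisms of algebras, where `H ⊗ H` is the braided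
  tensor product -/
  comul_one : Coalgebra.comul (R := k) (1 : H) = 1 ⊗ₜ[k] 1
  comul_mul : Coalgebra.comul ∘ₗ LinearMap.mul' k H =
    braidedMul toYDMaps ∘ₗ TensorProduct.map Coalgebra.comul Coalgebra.comul
  counit_one : Coalgebra.counit (R := k) (1 : H) = 1
  counit_mul : ∀ x y : H, Coalgebra.counit (R := k) (x * y) =
    Coalgebra.counit (R := k) x * Coalgebra.counit (R := k) y
  /-- the antipode of `H` -/
  antipode : H →ₗ[k] H
  isHom_antipode : toYDMaps.IsHom toYDMaps antipode
  /-- `∑ S(h₁) h₂ = ε(h) 1` -/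
  antipode_mul : LinearMap.mul' k H ∘ₗ antipode.rTensor H ∘ₗ Coalgebra.comul =
    Algebra.linearMap k H ∘ₗ Coalgebra.counit
  /-- `∑ h₁ S(h₂) = ε(h) 1` -/
  mul_antipode : LinearMap.mul' k H ∘ₗ antipode.lTensor H ∘ₗ Coalgebra.comul =
    Algebra.linearMap k H ∘ₗ Coalgebra.counit

end YetterDrinfeld

/-- The space `∫ˡ` of the dual `H^*`: all `f ∈ H^*` with `g * f = g(1) f` for every `g ∈ H^*`,
where `*` is the convolution product `(g * f)(h) = ∑ g(h₁) f(h₂)`. -/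
def leftIntegrals (k H : Type*) [Field k] [Ring H] [Algebra k H] [Coalgebra k H] :
    Submodule k (Module.Dual k H) where
  carrier := {f | ∀ g : Module.Dual k H,
    WithConv.toConv g * WithConv.toConv f = g 1 • WithConv.toConv f}
  add_mem' {a b} ha hb g := by
    rw [WithConv.toConv_add, mul_add, ha g, hb g, smul_add]
  zero_mem' g := by
    rw [WithConv.toConv_zero, mul_zero, smul_zero]
  smul_mem' c f hf g := by
    rw [WithConv.toConv_smul, mul_smul_comm, hf g, smul_comm]

end BraidedIntegral

end

namespace BraidedIntegral

open Coalgebra HopfAlgebra WithConv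

section HopfAlgebra

variable {k H : Type*} [Field k] [Ring H] [HopfAlgebra k H]

/-! A trivial coaction turns the braiding into the flip, so `H` is an ordinary Hopf algebra, and the
claim becomes uniqueness of integrals in arbitrary dimension. Members of `leftIntegrals` are left
invariant functionals. Two facts carry the argument. A nonzero invariant functional is faithful on
one side (`eq_zero_of_forall_mul`), by exchanging `∑ φ(a b₂) b₁` with `∑ φ(a₂ b) S(a₁)`. And for `φ`
left and `ψ ≠ 0` right invariant, `ker (ψ ∘ S) ≤ ker φ` (`eq_zero_of_antipode`), so every left
integral is a multiple of `ψ ∘ S`. A nonzero left integral `φ` supplies `ψ = φ ∘ S`. Bijectivity of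
`S` is never needed. -/

/-- `∑ a₁ φ(a₂) = φ(a) 1` for all `a`. -/
def IsLeftInvariant (φ : Module.Dual k H) : Prop :=
  ∀ a : H, TensorProduct.rid k H (φ.lTensor H (comul a)) = φ a • 1

/-- `∑ ψ(a₁) a₂ = ψ(a) 1` for all `a`. -/
def IsRightInvariant (ψ : Module.Dual k H) : Prop :=
  ∀ a : H, TensorProduct.lid k H (ψ.rTensor H (comul a)) = ψ a • 1

/-- The functional `f` as a map `H → H`, `a ↦ f(a) 1`. -/
def scalarMap {C : Type*} [AddCommGroup C] [Module k C] (H : Type*) [Ring H] [Algebra k H]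
    (f : C →ₗ[k] k) : C →ₗ[k] H :=
  f.smulRight 1

theorem IsLeftInvariant.sum_eq {φ : Module.Dual k H} (hφ : IsLeftInvariant φ) {a : H} {ι : Type*}
    (r : Coalgebra.Repr k a ι) : ∑ i ∈ r.index, φ (r.right i) • r.left i = φ a • 1 := by
  rw [← hφ a, ← r.eq]
  simp

theorem IsRightInvariant.sum_eq {ψ : Module.Dual k H} (hψ : IsRightInvariant ψ) {a : H}
    {ι : Type*} (r : Coalgebra.Repr k a ι) :
    ∑ i ∈ r.index, ψ (r.left i) • r.right i = ψ a • 1 := by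
  rw [← hψ a, ← r.eq]
  simp

/-! ### Exchange identities, by convolution in `Hom(H ⊗ H, H)` -/

variable (k H) in
/-- `a ⊗ b ↦ ε(b) a`. -/
def fstMap : H ⊗[k] H →ₗ[k] H :=
  (TensorProduct.rid k H).toLinearMap ∘ₗ (counit (R := k) (A := H)).lTensor H

variable (k H) in
/-- `a ⊗ b ↦ ε(a) b`. -/
def sndMap : H ⊗[k] H →ₗ[k] H :=
  (TensorProduct.lid k H).toLinearMap ∘ₗ (counit (R := k) (A := H)).rTensor H

theorem sum_counit_smul_right {a : H} {ι : Type*} (r : Coalgebra.Repr k a ι) :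
    ∑ i ∈ r.index, counit (R := k) (r.right i) • r.left i = a := by
  simpa only [map_sum, TensorProduct.rid_tmul, one_smul] using
    congrArg (TensorProduct.rid k H) (sum_tmul_counit_eq r)

section Evaluation

variable (g : H →ₗ[k] H) (F : H ⊗[k] H →ₗ[k] H) (a b : H) {ι : Type*}

theorem comp_fstMap_convMul_apply (r : Coalgebra.Repr k a ι) :
    (toConv (g ∘ₗ fstMap k H) * toConv F) (a ⊗ₜ[k] b) =
      ∑ i ∈ r.index, g (r.left i) * F (r.right i ⊗ₜ[k] b) := by
  rw [(r.tmul (ℛ k b)).convMul_apply]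
  refine (Finset.sum_product _ _ _).trans (Finset.sum_congr rfl fun i _ => ?_)
  conv_rhs => rw [← sum_counit_smul (ℛ k b)]
  simp [Coalgebra.Repr.tmul, fstMap, TensorProduct.tmul_sum, Finset.mul_sum]

theorem comp_sndMap_convMul_apply (r : Coalgebra.Repr k b ι) :
    (toConv (g ∘ₗ sndMap k H) * toConv F) (a ⊗ₜ[k] b) =
      ∑ i ∈ r.index, g (r.left i) * F (a ⊗ₜ[k] r.right i) := by
  rw [((ℛ k a).tmul r).convMul_apply]
  refine (Finset.sum_product_right _ _ _).trans (Finset.sum_congr rfl fun i _ => ?_)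
  conv_rhs => rw [← sum_counit_smul (ℛ k a)]
  simp [Coalgebra.Repr.tmul, sndMap, TensorProduct.sum_tmul, ← TensorProduct.smul_tmul',
    Finset.mul_sum]

theorem convMul_comp_fstMap_apply (r : Coalgebra.Repr k a ι) :
    (toConv F * toConv (g ∘ₗ fstMap k H)) (a ⊗ₜ[k] b) =
      ∑ i ∈ r.index, F (r.left i ⊗ₜ[k] b) * g (r.right i) := by
  rw [(r.tmul (ℛ k b)).convMul_apply]
  refine (Finset.sum_product _ _ _).trans (Finset.sum_congr rfl fun i _ => ?_)
  conv_rhs => rw [← sum_counit_smul_right (ℛ k b)]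
  simp [Coalgebra.Repr.tmul, fstMap, TensorProduct.tmul_sum, Finset.sum_mul]

theorem convMul_comp_sndMap_apply (r : Coalgebra.Repr k b ι) :
    (toConv F * toConv (g ∘ₗ sndMap k H)) (a ⊗ₜ[k] b) =
      ∑ i ∈ r.index, F (a ⊗ₜ[k] r.left i) * g (r.right i) := by
  rw [((ℛ k a).tmul r).convMul_apply]
  refine (Finset.sum_product_right _ _ _).trans (Finset.sum_congr rfl fun i _ => ?_)
  conv_rhs => rw [← sum_counit_smul_right (ℛ k a)]
  simp [Coalgebra.Repr.tmul, sndMap, TensorProduct.sum_tmul, ← TensorProduct.smul_tmul',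
    Finset.sum_mul]

end Evaluation

theorem fstMap_convMul_sndMap :
    toConv (fstMap k H) * toConv (sndMap k H) = toConv (LinearMap.mul' k H) := by
  ext a b
  refine (comp_fstMap_convMul_apply LinearMap.id (sndMap k H) a b (ℛ k a)).trans ?_
  conv_rhs => rw [← sum_counit_smul_right (ℛ k a)]
  simp [sndMap]

theorem antipode_fstMap_convMul_fstMap :
    toConv (antipode k ∘ₗ fstMap k H) * toConv (fstMap k H) = 1 := by
  ext a b
  refine (comp_fstMap_convMul_apply (antipode k) (fstMap k H) a b (ℛ k a)).trans ?_
  have := congrArg (counit (R := k) b • ·) (sum_antipode_mul_eq_smul (ℛ k a))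
  simpa [fstMap, Finset.smul_sum, Algebra.algebraMap_eq_smul_one, smul_smul, mul_comm] using this

theorem sndMap_convMul_antipode_sndMap :
    toConv (sndMap k H) * toConv (antipode k ∘ₗ sndMap k H) = 1 := by
  ext a b
  refine (convMul_comp_sndMap_apply (antipode k) (sndMap k H) a b (ℛ k b)).trans ?_
  have := congrArg (counit (R := k) a • ·) (sum_mul_antipode_eq_smul (ℛ k b))
  simpa [sndMap, Finset.smul_sum, Algebra.algebraMap_eq_smul_one, smul_smul, mul_comm] using this

theorem IsLeftInvariant.mul'_convMul {φ : Module.Dual k H} (hφ : IsLeftInvariant φ) :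
    toConv (LinearMap.mul' k H) * toConv (scalarMap H (φ ∘ₗ LinearMap.mul' k H)) =
      toConv (scalarMap H (φ ∘ₗ LinearMap.mul' k H)) := by
  ext a b
  simp only [TensorProduct.AlgebraTensorModule.curry_apply, TensorProduct.curry_apply,
    LinearMap.coe_restrictScalars]
  rw [((ℛ k a).tmul (ℛ k b)).convMul_apply]
  have := hφ.sum_eq ((ℛ k a).mul (ℛ k b))
  simpa [scalarMap] using this

theorem IsRightInvariant.convMul_mul' {ψ : Module.Dual k H} (hψ : IsRightInvariant ψ) :
    toConv (scalarMap H (ψ ∘ₗ LinearMap.mul' k H)) * toConv (LinearMap.mul' k H) =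
      toConv (scalarMap H (ψ ∘ₗ LinearMap.mul' k H)) := by
  ext a b
  simp only [TensorProduct.AlgebraTensorModule.curry_apply, TensorProduct.curry_apply,
    LinearMap.coe_restrictScalars]
  rw [((ℛ k a).tmul (ℛ k b)).convMul_apply]
  have := hψ.sum_eq ((ℛ k a).mul (ℛ k b))
  simpa [scalarMap] using this

/-- Invariance lets `fst * snd`, which is multiplication, be absorbed by `φ(ab) 1`; the convolution
inverse `S ∘ fst` then cancels `fst`. -/
theorem IsLeftInvariant.sndMap_convMul {φ : Module.Dual k H} (hφ : IsLeftInvariant φ) :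
    toConv (sndMap k H) * toConv (scalarMap H (φ ∘ₗ LinearMap.mul' k H)) =
      toConv (antipode k ∘ₗ fstMap k H) * toConv (scalarMap H (φ ∘ₗ LinearMap.mul' k H)) := by
  conv_rhs => rw [← hφ.mul'_convMul, ← fstMap_convMul_sndMap]
  rw [mul_assoc, ← mul_assoc, antipode_fstMap_convMul_fstMap, one_mul]

theorem IsRightInvariant.convMul_fstMap {ψ : Module.Dual k H} (hψ : IsRightInvariant ψ) :
    toConv (scalarMap H (ψ ∘ₗ LinearMap.mul' k H)) * toConv (fstMap k H) =
      toConv (scalarMap H (ψ ∘ₗ LinearMap.mul' k H)) * toConv (antipode k ∘ₗ sndMap k H) := by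
  conv_rhs => rw [← hψ.convMul_mul', ← fstMap_convMul_sndMap]
  rw [mul_assoc, mul_assoc, sndMap_convMul_antipode_sndMap, mul_one]

/-- `∑ φ(a b₂) b₁ = ∑ φ(a₂ b) S(a₁)` for a left invariant functional `φ`. -/
theorem IsLeftInvariant.sum_smul_eq_sum_smul_antipode {φ : Module.Dual k H}
    (hφ : IsLeftInvariant φ) {a b : H} {ι κ : Type*} (r : Coalgebra.Repr k a ι)
    (s : Coalgebra.Repr k b κ) :
    ∑ j ∈ s.index, φ (a * s.right j) • s.left j =
      ∑ i ∈ r.index, φ (r.right i * b) • antipode k (r.left i) := by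
  have h := congrArg (fun f => f (a ⊗ₜ[k] b)) hφ.sndMap_convMul
  have h₁ := comp_sndMap_convMul_apply LinearMap.id (scalarMap H (φ ∘ₗ LinearMap.mul' k H)) a b s
  have h₂ := comp_fstMap_convMul_apply (antipode k) (scalarMap H (φ ∘ₗ LinearMap.mul' k H)) a b r
  simpa [scalarMap] using h₁.symm.trans (h.trans h₂)

/-- `∑ ψ(a₁ b) a₂ = ∑ ψ(a b₁) S(b₂)` for a right invariant functional `ψ`. -/
theorem IsRightInvariant.sum_smul_eq_sum_smul_antipode {ψ : Module.Dual k H}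
    (hψ : IsRightInvariant ψ) {a b : H} {ι κ : Type*} (r : Coalgebra.Repr k a ι)
    (s : Coalgebra.Repr k b κ) :
    ∑ i ∈ r.index, ψ (r.left i * b) • r.right i =
      ∑ j ∈ s.index, ψ (a * s.left j) • antipode k (s.right j) := by
  have h := congrArg (fun f => f (a ⊗ₜ[k] b)) hψ.convMul_fstMap
  have h₁ := convMul_comp_fstMap_apply LinearMap.id (scalarMap H (ψ ∘ₗ LinearMap.mul' k H)) a b r
  have h₂ := convMul_comp_sndMap_apply (antipode k) (scalarMap H (ψ ∘ₗ LinearMap.mul' k H)) a b s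
  simpa [scalarMap] using h₁.symm.trans (h.trans h₂)

/-! ### Faithfulness of invariant functionals -/

variable (k) in
/-- A representation of `comul a` whose left factors are distinct members of a basis. -/
theorem exists_repr_linearIndependent_left (a : H) :
    ∃ r : Coalgebra.Repr k a (Module.Basis.ofVectorSpaceIndex k H), LinearIndependent k r.left := by
  obtain ⟨c, hc⟩ := TensorProduct.eq_repr_basis_left (Module.Basis.ofVectorSpace k H)
    (comul (R := k) a)
  exact ⟨⟨c.support, Module.Basis.ofVectorSpace k H, c, hc⟩,
    (Module.Basis.ofVectorSpace k H).linearIndependent⟩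

variable (k) in
/-- A representation of `comul a` whose right factors are distinct members of a basis. -/
theorem exists_repr_linearIndependent_right (a : H) :
    ∃ r : Coalgebra.Repr k a (Module.Basis.ofVectorSpaceIndex k H),
      LinearIndependent k r.right := by
  obtain ⟨c, hc⟩ := TensorProduct.eq_repr_basis_right (Module.Basis.ofVectorSpace k H)
    (comul (R := k) a)
  exact ⟨⟨c.support, c, Module.Basis.ofVectorSpace k H, hc⟩,
    (Module.Basis.ofVectorSpace k H).linearIndependent⟩

/-- Let `N` be the space of all `y` with `φ(Hy) = 0`. The exchange identity gives `Δ(N) ⊆ H ⊗ N`.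
Hence `ε(y) φ(a) = ∑ φ(a S(y₁) y₂) = 0` on `N`, so `ε` kills `N`, and `x = ∑ ε(x₂) x₁ = 0`. -/
theorem IsLeftInvariant.eq_zero_of_forall_mul {φ : Module.Dual k H} (hφ : IsLeftInvariant φ)
    (hφ0 : φ ≠ 0) {x : H} (hx : ∀ a, φ (a * x) = 0) : x = 0 := by
  have right_mem (y : H) (hy : ∀ a, φ (a * y) = 0) {ι : Type _} (r : Coalgebra.Repr k y ι)
      (hr : LinearIndependent k r.left) (i : ι) (hi : i ∈ r.index) (a : H) :
      φ (a * r.right i) = 0 := by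
    refine linearIndependent_iff'.mp hr r.index (fun j => φ (a * r.right j)) ?_ i hi
    rw [hφ.sum_smul_eq_sum_smul_antipode (ℛ k a) r]
    simp [hy]
  have counit_eq_zero (y : H) (hy : ∀ a, φ (a * y) = 0) : counit (R := k) y = 0 := by
    obtain ⟨r, hr⟩ := exists_repr_linearIndependent_left k y
    obtain ⟨a, ha⟩ := DFunLike.ne_iff.mp hφ0
    have h := congrArg (fun z => φ (a * z)) (sum_antipode_mul_eq_smul r)
    simp only [Finset.mul_sum, map_sum, ← mul_assoc] at h
    rw [Finset.sum_eq_zero fun i hi => right_mem y hy r hr i hi _] at h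
    simpa [show φ a ≠ 0 from ha] using h.symm
  obtain ⟨r, hr⟩ := exists_repr_linearIndependent_left k x
  rw [← sum_counit_smul_right r]
  exact Finset.sum_eq_zero fun i hi => by
    rw [counit_eq_zero _ (right_mem x hx r hr i hi), zero_smul]

theorem IsRightInvariant.eq_zero_of_forall_mul {ψ : Module.Dual k H} (hψ : IsRightInvariant ψ)
    (hψ0 : ψ ≠ 0) {x : H} (hx : ∀ b, ψ (x * b) = 0) : x = 0 := by
  have left_mem (y : H) (hy : ∀ b, ψ (y * b) = 0) {ι : Type _} (r : Coalgebra.Repr k y ι)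
      (hr : LinearIndependent k r.right) (i : ι) (hi : i ∈ r.index) (b : H) :
      ψ (r.left i * b) = 0 := by
    refine linearIndependent_iff'.mp hr r.index (fun j => ψ (r.left j * b)) ?_ i hi
    rw [hψ.sum_smul_eq_sum_smul_antipode r (ℛ k b)]
    simp [hy]
  have counit_eq_zero (y : H) (hy : ∀ b, ψ (y * b) = 0) : counit (R := k) y = 0 := by
    obtain ⟨r, hr⟩ := exists_repr_linearIndependent_right k y
    obtain ⟨b, hb⟩ := DFunLike.ne_iff.mp hψ0
    have h := congrArg (fun z => ψ (z * b)) (sum_mul_antipode_eq_smul r)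
    simp only [Finset.sum_mul, map_sum, mul_assoc] at h
    rw [Finset.sum_eq_zero fun i hi => left_mem y hy r hr i hi _] at h
    simpa [show ψ b ≠ 0 from hb] using h.symm
  obtain ⟨r, hr⟩ := exists_repr_linearIndependent_right k x
  rw [← sum_counit_smul r]
  exact Finset.sum_eq_zero fun i hi => by
    rw [counit_eq_zero _ (left_mem x hx r hr i hi), zero_smul]

/-! ### The antipode carries left invariance to right invariance -/

theorem comul_comp_antipode :
    toConv (comul ∘ₗ antipode k) =
      toConv ((Algebra.TensorProduct.includeRight : H →ₐ[k] H ⊗[k] H).toLinearMap ∘ₗ antipode k) *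
      toConv ((Algebra.TensorProduct.includeLeft : H →ₐ[k] H ⊗[k] H).toLinearMap ∘ₗ antipode k) := by
  have cancel (f : H →ₐ[k] H ⊗[k] H) :
      toConv (f.toLinearMap ∘ₗ antipode k) * toConv f.toLinearMap = 1 := by
    have h := LinearMap.algHom_comp_convMul_distrib f (toConv (antipode k (A := H)))
      (toConv LinearMap.id)
    rw [LinearMap.antipode_mul_id] at h
    refine (congrArg toConv h).symm.trans ?_
    ext; simp
  have comul_eq : toConv (comul (R := k) (A := H)) =
      toConv (Algebra.TensorProduct.includeLeft : H →ₐ[k] H ⊗[k] H).toLinearMap *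
      toConv (Algebra.TensorProduct.includeRight : H →ₐ[k] H ⊗[k] H).toLinearMap := by
    ext a
    rw [(ℛ k a).convMul_apply]
    simp [Coalgebra.Repr.eq]
  -- Both sides are convolution inverses of `comul` in `Hom(H, H ⊗ H)`.
  refine (left_inv_eq_right_inv ?_ LinearMap.comul_right_inv).symm
  rw [comul_eq, mul_assoc]
  conv_lhs => rw [← mul_assoc (toConv (_ ∘ₗ antipode k)) (toConv (AlgHom.toLinearMap _)), cancel,
    one_mul]
  exact cancel _

/-- A representation of `comul (S a)` obtained from one of `comul a`. -/
def antipodeRepr {a : H} {ι : Type*} (r : Coalgebra.Repr k a ι) :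
    Coalgebra.Repr k (antipode k a) ι where
  index := r.index
  left i := antipode k (r.right i)
  right i := antipode k (r.left i)
  eq := by
    have h := congrArg (fun f => f a) (comul_comp_antipode (k := k) (H := H))
    simp only [r.convMul_apply] at h
    simpa using h.symm

theorem IsLeftInvariant.comp_antipode {φ : Module.Dual k H} (hφ : IsLeftInvariant φ) :
    IsRightInvariant (φ ∘ₗ antipode k) := by
  have h : toConv (scalarMap H (φ ∘ₗ antipode k)) * toConv (antipode k) =
      toConv (scalarMap H (φ ∘ₗ antipode k)) := by
    ext a
    rw [(ℛ k a).convMul_apply]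
    simpa [scalarMap, antipodeRepr] using hφ.sum_eq (antipodeRepr (ℛ k a))
  -- Convolving `h` with `id` on the right replaces `S` by `id`.
  have h' : toConv (scalarMap H (φ ∘ₗ antipode k)) * toConv LinearMap.id =
      toConv (scalarMap H (φ ∘ₗ antipode k)) := by
    conv_lhs => rw [← h, mul_assoc, LinearMap.antipode_mul_id, mul_one]
  intro a
  have := congrArg (fun f => f a) h'
  simp only [(ℛ k a).convMul_apply] at this
  rw [← (ℛ k a).eq]
  simpa [scalarMap] using this

/-- If `φ ∘ S = 0`, applying `φ` to the exchange identity gives `φ(a ∑ φ(b₁) b₂) = 0` for all `a`;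
faithfulness and then `ε` give `φ(b) = 0`. -/
theorem IsLeftInvariant.comp_antipode_ne_zero {φ : Module.Dual k H} (hφ : IsLeftInvariant φ)
    (hφ0 : φ ≠ 0) : φ ∘ₗ antipode k ≠ 0 := by
  intro h0
  refine hφ0 (LinearMap.ext fun b => ?_)
  have hb : ∑ j ∈ (ℛ k b).index, φ ((ℛ k b).left j) • (ℛ k b).right j = 0 := by
    refine hφ.eq_zero_of_forall_mul hφ0 fun a => ?_
    have h := congrArg φ (hφ.sum_smul_eq_sum_smul_antipode (ℛ k a) (ℛ k b))
    simp only [map_sum, map_smul, smul_eq_mul] at h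
    have h0' (x : H) : φ (antipode k x) = 0 := LinearMap.congr_fun h0 x
    simpa [h0', Finset.mul_sum, mul_comm] using h
  have := congrArg (counit (R := k)) hb
  conv_lhs => rw [← sum_counit_smul_right (ℛ k b)]
  simpa [mul_comm] using this

/-! ### Comparison of left and right invariant functionals -/

/-- `φ(a) ψ(b) = ∑ ψ(S(a₁)) φ(a₂ b)` for `φ` left and `ψ` right invariant. -/
theorem IsLeftInvariant.sum_antipode_mul {φ ψ : Module.Dual k H} (hφ : IsLeftInvariant φ)
    (hψ : IsRightInvariant ψ) {a : H} {ι : Type*} (r : Coalgebra.Repr k a ι) (b : H) :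
    ∑ i ∈ r.index, ψ (antipode k (r.left i)) * φ (r.right i * b) = φ a * ψ b := by
  have h := congrArg ψ (hφ.sum_smul_eq_sum_smul_antipode r (ℛ k b))
  have h' := congrArg (fun z => φ (a * z)) (hψ.sum_eq (ℛ k b))
  simp only [map_sum, map_smul, smul_eq_mul, Finset.mul_sum, mul_smul_comm, mul_one] at h h'
  rw [mul_comm (φ a), ← h']
  simp only [mul_comm (ψ _)]
  exact h.symm

/-- `∑ φ(a₁) ψ(S(a₂) b) = ψ(S(a)) φ(b)` for `φ` left and `ψ` right invariant. -/
theorem IsLeftInvariant.sum_mul_antipode {φ ψ : Module.Dual k H} (hφ : IsLeftInvariant φ)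
    (hψ : IsRightInvariant ψ) {a : H} {ι : Type*} (r : Coalgebra.Repr k a ι) (b : H) :
    ∑ i ∈ r.index, φ (r.left i) * ψ (antipode k (r.right i) * b) = ψ (antipode k a) * φ b := by
  have h : (toConv (scalarMap H (ψ ∘ₗ antipode k)) * toConv LinearMap.id) * toConv (antipode k) =
      toConv (scalarMap H (ψ ∘ₗ antipode k)) := by
    rw [mul_assoc, LinearMap.id_mul_antipode, mul_one]
  have h' := congrArg (fun f => φ (f a * b)) h
  simp only [r.convMul_apply, Finset.sum_mul, map_sum] at h'
  have h'' : φ (scalarMap H (ψ ∘ₗ antipode k) a * b) = ψ (antipode k a) * φ b := by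
    simp [scalarMap]
  rw [← h'', ← h']
  -- Termwise, `sum_antipode_mul` at `a₁` and `S(a₂) b` matches `∑ ψ(S(a₁)) φ(a₂ S(a₃) b)`.
  refine Finset.sum_congr rfl fun i _ => ?_
  rw [← hφ.sum_antipode_mul hψ (ℛ k (r.left i)), (ℛ k (r.left i)).convMul_apply]
  simp [scalarMap, Finset.sum_mul, mul_assoc]

/-- By `sum_mul_antipode` and faithfulness of `ψ`, `∑ φ(a₁) S(a₂) = 0`; apply `ε`, using `ε ∘ S =
ε`. -/
theorem IsLeftInvariant.eq_zero_of_antipode {φ ψ : Module.Dual k H} (hφ : IsLeftInvariant φ)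
    (hψ : IsRightInvariant ψ) (hψ0 : ψ ≠ 0) {a : H} (ha : ψ (antipode k a) = 0) : φ a = 0 := by
  have h : ∑ i ∈ (ℛ k a).index, φ ((ℛ k a).left i) • antipode k ((ℛ k a).right i) = 0 := by
    refine hψ.eq_zero_of_forall_mul hψ0 fun b => ?_
    simpa [Finset.sum_mul, ha] using hφ.sum_mul_antipode hψ (ℛ k a) b
  have := congrArg (counit (R := k)) h
  rw [← sum_counit_smul_right (ℛ k a)]
  simpa [mul_comm] using this

theorem isLeftInvariant_of_mem_leftIntegrals {φ : Module.Dual k H}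
    (hφ : φ ∈ leftIntegrals k H) : IsLeftInvariant φ := by
  intro a
  rw [← sub_eq_zero, ← Module.forall_dual_apply_eq_zero_iff k]
  intro g
  have h := congrArg (fun f => f a) (hφ g)
  simp only [(ℛ k a).convMul_apply] at h
  rw [← (ℛ k a).eq]
  simpa [sub_eq_zero, mul_comm] using h

theorem rank_leftIntegrals_le_one (k H : Type*) [Field k] [Ring H] [HopfAlgebra k H] :
    Module.rank k (leftIntegrals k H) ≤ 1 := by
  by_cases h : ∃ φ ∈ leftIntegrals k H, φ ≠ 0
  · obtain ⟨φ, hφ, hφ0⟩ := h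
    have hφl := isLeftInvariant_of_mem_leftIntegrals hφ
    refine (Submodule.rank_mono (t := k ∙ ((φ ∘ₗ antipode k) ∘ₗ antipode k : Module.Dual k H))
      fun χ hχ => ?_).trans (rank_span_le _ |>.trans (by simp))
    -- A functional vanishing on the kernel of another is a multiple of it; here `ψ = φ ∘ S`, hence
    -- the double antipode.
    have := mem_span_of_iInf_ker_le_ker (ι := Unit)
      (L := fun _ => (φ ∘ₗ antipode k) ∘ₗ antipode k) (K := χ) fun a ha => ?_
    · simpa using this
    · exact (isLeftInvariant_of_mem_leftIntegrals hχ).eq_zero_of_antipode hφl.comp_antipode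
        (hφl.comp_antipode_ne_zero hφ0) (by simpa using ha)
  · push Not at h
    rw [(Submodule.eq_bot_iff _).mpr h]
    simp

end HopfAlgebra

/-! ### Reduction to ordinary Hopf algebras -/

namespace BraidedHopfAlgebra

variable {k B H : Type*} [Field k] [Ring B] [HopfAlgebra k B] [Ring H] [Algebra k H]
  [Coalgebra k H] (X : BraidedHopfAlgebra k B H)

theorem braidedMul_eq_mul (hX : X.toYDMaps.IsTrivialCoaction) (s t : H ⊗[k] H) :
    braidedMul X.toYDMaps (s ⊗ₜ[k] t) = s * t := by
  induction s with
  | zero => simp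
  | add s₁ s₂ h₁ h₂ => rw [TensorProduct.add_tmul, map_add, h₁, h₂, add_mul]
  | tmul u v =>
    induction t with
    | zero => simp
    | add t₁ t₂ h₁ h₂ => rw [TensorProduct.tmul_add, map_add, h₁, h₂, mul_add]
    | tmul x y =>
      -- The braiding sends `v ⊗ x` to `1 · x ⊗ v = x ⊗ v`.
      simp [braidedMul, YDMaps.braiding, hX v, X.isYetterDrinfeld.one_act]

/-- A braided Hopf algebra with trivial coaction is an ordinary Hopf algebra. -/
abbrev toHopfAlgebra (hX : X.toYDMaps.IsTrivialCoaction) : HopfAlgebra k H :=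
  { Bialgebra.mk' k H X.counit_one (X.counit_mul _ _) X.comul_one (by
      intro a b
      have h := LinearMap.congr_fun X.comul_mul (a ⊗ₜ[k] b)
      simpa [X.braidedMul_eq_mul hX] using h) with
    antipode := X.antipode
    mul_antipode_rTensor_comul := X.antipode_mul
    mul_antipode_lTensor_comul := X.mul_antipode }

end BraidedHopfAlgebra

end BraidedIntegral

theorem mainTheorem6 {k B H : Type*} [Field k] [Ring B] [HopfAlgebra k B] [FiniteDimensional k B]
    [Ring H] [Algebra k H] [Coalgebra k H] (X : BraidedIntegral.BraidedHopfAlgebra k B H)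
    (hX : X.toYDMaps.IsTrivialCoaction) :
    Module.rank k (BraidedIntegral.leftIntegrals k H) = 0 ∨
      Module.rank k (BraidedIntegral.leftIntegrals k H) = 1 := by
  let _ := X.toHopfAlgebra hX
  have h : Module.rank k (BraidedIntegral.leftIntegrals k H) ≤ 1 :=
    BraidedIntegral.rank_leftIntegrals_le_one k H
  exact Cardinal.le_one_iff.mp h
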